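/- Let $(E,d)$ be a complete separable metric space with its Borel $\sigma$-algebra, and let $q>0$. Let $\mathcal P^q(E)$ be the set of Borel probability measures $\mu$ on $E$ with $\inf_{x_0\in E}\left(\int_E d(x,x_0)^q\,\mu(\mathrm dx)\right)^{1/q}<\infty$, and define the $q$-Wasserstein distance by $$W_q(\mu,\nu)=\inf_{\pi\in\Pi(\mu,\nu)}\left(\int_{E\times E} d(x,y)^q\,\pi(\mathrm dx\,\mathrm dy)\right)^{1/q},$$ where $\Pi(\mu,\nu)$ is the set of probability measures on $E\times E$ with marginals $\mu$ and $\nu$. Let $\Phi\colon E\to[0,\infty)$ be continuous, and for a probability measure $\nu$ on $E$ define the posterior $$\nu_\Phi(\mathrm dx)=\frac{1}{Z_\nu}\,e^{-\Phi(x)}\,\nu(\mathrm dx),\qquad Z_\nu=\int_E e^{-\Phi(x)}\,\nu(\mathrm dx).$$ Let $\mu\in\mathcal P^q(E)$ and let $(\tilde\mu^{(k)})_{k\in\mathbb N}$ be a sequence in $\mathcal P^q(E)$. Then the posteriors $\mu_\Phi$ and $\tilde\mu^{(k)}_\Phi$, $k\in\mathbb N$, belong to $\mathcal P^q(E)$,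 and $$W_q(\mu,\tilde\mu^{(k)})\to0\ (k\to\infty)\quad\text{implies}\quad W_q(\mu_\Phi,\tilde\mu^{(k)}_\Phi)\to0\ (k\to\infty).$$ -/

import Mathlib

open MeasureTheory Filter Topology
open scoped ENNReal

noncomputable section

/-- The quantity `|μ|_{P^q} = inf_{x₀} (∫ d(x, x₀)^q μ(dx))^{1/q}`, with values in `[0, ∞]`. -/
def momentNorm {E : Type*} [MetricSpace E] [MeasurableSpace E] (q : ℝ) (μ : Measure E) : ℝ≥0∞ :=
  ⨅ x₀ : E, (∫⁻ x, edist x x₀ ^ q ∂μ) ^ (1 / q)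

/-- `P^q(E)`: the Borel probability measures `μ` on `E` with `|μ|_{P^q} < ∞`. -/
def probMeasuresWithMoment (E : Type*) [MetricSpace E] [MeasurableSpace E] (q : ℝ) :
    Set (Measure E) :=
  {μ | IsProbabilityMeasure μ ∧ momentNorm q μ < ∞}

/-- `Π(μ, ν)`: the probability measures on `E × E` with marginals `μ` and `ν`. -/
def couplings {E : Type*} [MeasurableSpace E] (μ ν : Measure E) : Set (Measure (E × E)) :=
  {π | IsProbabilityMeasure π ∧ π.fst = μ ∧ π.snd = ν}

/-- The `q`-Wasserstein distance `inf_π (∫ d(x, y)^q π(dx dy))^{1/q}` over all couplings `π`,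
with values in `[0, ∞]`. -/
def wassersteinDist {E : Type*} [MetricSpace E] [MeasurableSpace E] (q : ℝ) (μ ν : Measure E) :
    ℝ≥0∞ :=
  ⨅ π ∈ couplings μ ν, (∫⁻ z, edist z.1 z.2 ^ q ∂π) ^ (1 / q)

/-- The posterior `μ_Φ(dx) = Z⁻¹ exp(-Φ(x)) μ(dx)` with `Z = ∫ exp(-Φ) dμ`, which is the
exponential tilting of the prior `μ` by `-Φ`. -/
def posterior {E : Type*} [MeasurableSpace E] (μ : Measure E) (Φ : E → ℝ) : Measure E :=
  μ.tilted (fun x => -Φ x)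

end

/-!
Stability of posteriors in the Wasserstein distance, by an explicit construction of couplings.

Write `ψ = exp (-Φ)`, with values in `(0, 1]`, and let `π` be a coupling of the priors `μ` and `ν`.
The posteriors have the densities `f = ψ / Z_μ` and `g = ψ / Z_ν`. The measure `min (f x) (g y) π`
has marginals below the two posteriors, and what is missing on either side has the same mass;
coupling these remainders independently gives a coupling of the posteriors
(`exists_coupling_withDensity`). Its cost is at most the cost of the common part, which is
`O(∫ d(x, y)^q dπ)`, plus a multiple of the `q`-th moments of the remainders, which are bounded by
integrals of `(d(x, x₀)^q + d(x, y)^q) |f x - g y|` under `π` (`wassersteinDist_posterior_le`).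

It remains to see that `∫ F(x) |ψ x - ψ y| dπ_k → 0` for `μ`-integrable `F` when the couplings `π_k`
have the fixed first marginal `μ` and vanishing cost (`tendsto_lintegral_mul_edist`). Since
`|ψ x - ψ y| ≤ ω_n(x) + n d(x, y)^q` with the penalised oscillation
`ω_n(x) = sup_y (|ψ x - ψ y| - n d(x, y)^q)^+`, which decreases to zero by the continuity of `ψ`,
this follows from dominated convergence under the single measure `μ`. With `F = 1` it also gives
the convergence of the normalising constants. Neither tightness nor weak convergence is needed.
-/

/-! ### Cost estimates -/

lemma edist_rpow_le {E : Type*} [PseudoEMetricSpace E] {q : ℝ} (hq : 0 ≤ q) (x y z : E) :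
    edist x z ^ q ≤ 2 ^ q * (edist x y ^ q + edist y z ^ q) := by
  have hmax : edist x z ≤ 2 * max (edist x y) (edist y z) := by
    rw [two_mul]
    exact (edist_triangle x y z).trans (add_le_add (le_max_left _ _) (le_max_right _ _))
  calc edist x z ^ q ≤ (2 * max (edist x y) (edist y z)) ^ q := by gcongr
    _ = 2 ^ q * max (edist x y) (edist y z) ^ q := ENNReal.mul_rpow_of_nonneg _ _ hq
    _ ≤ 2 ^ q * (edist x y ^ q + edist y z ^ q) := by
      gcongr
      rcases max_choice (edist x y) (edist y z) with h | h <;> rw [h]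
      · exact le_self_add
      · exact le_add_self

/-! ### Convergence under couplings with a fixed first marginal -/

/-- The oscillation of `ψ` at `x`, penalised by the cost: the least `w ≥ 0` such that
`|ψ x - ψ y| ≤ w + n d(x, y)^q` for all `y`. -/
noncomputable def penalizedOsc {E : Type*} [MetricSpace E] (q : ℝ) (ψ : E → ℝ) (n : ℕ)
    (x : E) : ℝ≥0∞ :=
  ⨆ y, (edist (ψ x) (ψ y) - n * edist x y ^ q)

lemma edist_le_penalizedOsc_add {E : Type*} [MetricSpace E] (q : ℝ) (ψ : E → ℝ) (n : ℕ)
    (x y : E) : edist (ψ x) (ψ y) ≤ penalizedOsc q ψ n x + n * edist x y ^ q :=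
  tsub_le_iff_right.1 (le_iSup (fun y => edist (ψ x) (ψ y) - n * edist x y ^ q) y)

lemma penalizedOsc_le_one {E : Type*} [MetricSpace E] {q : ℝ} {ψ : E → ℝ}
    (hψ : ∀ x y, edist (ψ x) (ψ y) ≤ 1) (n : ℕ) (x : E) : penalizedOsc q ψ n x ≤ 1 :=
  iSup_le fun y => tsub_le_self.trans (hψ x y)

lemma measurable_penalizedOsc {E : Type*} [MetricSpace E] [MeasurableSpace E] [BorelSpace E]
    (q : ℝ) {ψ : E → ℝ} (hψ : Continuous ψ) (n : ℕ) :
    Measurable (penalizedOsc q ψ n) := by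
  refine LowerSemicontinuous.measurable (lowerSemicontinuous_iSup fun y => ?_)
  refine Continuous.lowerSemicontinuous ?_
  refine ENNReal.continuousOn_sub.comp_continuous (f := fun x => (edist (ψ x) (ψ y),
    (n : ℝ≥0∞) * edist x y ^ q)) ?_ fun x h => edist_ne_top _ _ (congrArg Prod.fst h)
  refine (hψ.edist continuous_const).prodMk ?_
  exact (ENNReal.continuous_const_mul (ENNReal.natCast_ne_top n)).comp
    (ENNReal.continuous_rpow_const.comp (continuous_id.edist continuous_const))

/-- At a point of continuity the penalised oscillation vanishes in the limit: nearby points have a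
small oscillation, and at a distance at least `δ` the penalty `n δ ^ q` exceeds it. -/
lemma tendsto_penalizedOsc {E : Type*} [MetricSpace E] {q : ℝ} (hq : 0 < q) {ψ : E → ℝ}
    (hψ : Continuous ψ) (hψ1 : ∀ x y, edist (ψ x) (ψ y) ≤ 1) (x : E) :
    Tendsto (fun n => penalizedOsc q ψ n x) atTop (𝓝 0) := by
  rw [ENNReal.tendsto_nhds_zero]
  intro ε hε
  obtain ⟨δ, hδ, h⟩ := EMetric.continuous_iff.1 hψ x ε hε
  have hpos : 0 < δ ^ q := ENNReal.rpow_pos_of_nonneg hδ hq.le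
  obtain ⟨N, hN⟩ := ENNReal.exists_nat_mul_gt hpos.ne' ENNReal.one_ne_top
  filter_upwards [eventually_ge_atTop N] with n hn
  refine iSup_le fun y => ?_
  by_cases hy : edist y x < δ
  · refine tsub_le_self.trans ?_
    rw [edist_comm]
    exact (h y hy).le
  · rw [tsub_eq_zero_of_le]
    · exact zero_le
    · refine (hψ1 x y).trans (hN.le.trans ?_)
      rw [not_lt, edist_comm] at hy
      gcongr

/-- If `πᵢ` all have the first marginal `μ` and their transport costs tend to zero, then
`|ψ x - ψ y|` tends to zero in `πᵢ`-mean, even with a `μ`-integrable weight `F x`. -/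
lemma tendsto_lintegral_mul_edist {E : Type*} [MetricSpace E] [MeasurableSpace E] [BorelSpace E]
    [SecondCountableTopology E] {ι : Type*} {l : Filter ι} {q : ℝ} (hq : 0 < q) {ψ : E → ℝ}
    (hψ : Continuous ψ) (hψ1 : ∀ x y, edist (ψ x) (ψ y) ≤ 1) {μ : Measure E}
    {π : ι → Measure (E × E)} (hπ : ∀ i, (π i).fst = μ)
    (hcost : Tendsto (fun i => ∫⁻ z, edist z.1 z.2 ^ q ∂π i) l (𝓝 0))
    {F : E → ℝ≥0∞} (hF : Measurable F) (hFtop : ∀ x, F x ≠ ∞) (hFint : ∫⁻ x, F x ∂μ ≠ ∞) :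
    Tendsto (fun i => ∫⁻ z, F z.1 * edist (ψ z.1) (ψ z.2) ∂π i) l (𝓝 0) := by
  have hosc := measurable_penalizedOsc q hψ
  have hA : Tendsto (fun n : ℕ => ∫⁻ x, (F x - n) ∂μ) atTop (𝓝 0) := by
    have := tendsto_lintegral_of_dominated_convergence (μ := μ) (F := fun (n : ℕ) x => F x - n)
      (f := fun _ => 0) F (fun n => hF.sub_const _) (fun n => .of_forall fun x => tsub_le_self)
      hFint (.of_forall fun x => ?_)
    · simpa using this
    · obtain ⟨N, hN⟩ := ENNReal.exists_nat_gt (hFtop x)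
      refine tendsto_const_nhds.congr' ?_
      filter_upwards [eventually_ge_atTop N] with n hn
      exact (tsub_eq_zero_of_le (hN.le.trans (by gcongr))).symm
  have hB : Tendsto (fun n : ℕ => ∫⁻ x, F x * penalizedOsc q ψ n x ∂μ) atTop (𝓝 0) := by
    have := tendsto_lintegral_of_dominated_convergence (μ := μ)
      (F := fun (n : ℕ) x => F x * penalizedOsc q ψ n x)
      (f := fun _ => 0) F (fun n => hF.mul (hosc n))
      (fun n => .of_forall fun x => mul_le_of_le_one_right' (penalizedOsc_le_one hψ1 n x))
      hFint (.of_forall fun x => ?_)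
    · simpa using this
    · simpa using ENNReal.Tendsto.const_mul (tendsto_penalizedOsc hq hψ hψ1 x) (.inr (hFtop x))
  -- Truncate the weight at height `n` and penalise the oscillation with the same factor `n`.
  have hbound (n : ℕ) (i : ι) : ∫⁻ z, F z.1 * edist (ψ z.1) (ψ z.2) ∂π i ≤
      (∫⁻ x, (F x - n) ∂μ + ∫⁻ x, F x * penalizedOsc q ψ n x ∂μ) +
        (n * n) * ∫⁻ z, edist z.1 z.2 ^ q ∂π i := by
    have h1 : ∫⁻ x, (F x - n) ∂μ = ∫⁻ z, (F z.1 - n) ∂π i := by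
      rw [← hπ i, Measure.fst, lintegral_map (hF.sub_const _) measurable_fst]
    have h2 : ∫⁻ x, F x * penalizedOsc q ψ n x ∂μ = ∫⁻ z, F z.1 * penalizedOsc q ψ n z.1 ∂π i := by
      rw [← hπ i]
      exact lintegral_map (hF.mul (hosc n)) measurable_fst
    rw [h1, h2, ← lintegral_const_mul' _ _ (by finiteness),
      ← lintegral_add_left (by fun_prop), ← lintegral_add_left]
    · refine lintegral_mono fun z => ?_
      have hsplit : F z.1 ≤ (F z.1 - n) + min (F z.1) n := by
        rcases le_total (F z.1) n with h | h
        · simp [h]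
        · simp [h, tsub_add_cancel_of_le h]
      calc F z.1 * edist (ψ z.1) (ψ z.2)
          ≤ ((F z.1 - n) + min (F z.1) n) * edist (ψ z.1) (ψ z.2) := by gcongr
        _ = (F z.1 - n) * edist (ψ z.1) (ψ z.2) + min (F z.1) n * edist (ψ z.1) (ψ z.2) :=
          add_mul _ _ _
        _ ≤ (F z.1 - n) * 1 +
            min (F z.1) n * (penalizedOsc q ψ n z.1 + n * edist z.1 z.2 ^ q) := by
          gcongr
          · exact hψ1 _ _
          · exact edist_le_penalizedOsc_add q ψ n z.1 z.2
        _ ≤ (F z.1 - n) * 1 +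
            (F z.1 * penalizedOsc q ψ n z.1 + n * (n * edist z.1 z.2 ^ q)) := by
          rw [mul_add]
          gcongr
          · exact min_le_left _ _
          · exact min_le_right _ _
        _ = _ := by rw [mul_one, ← add_assoc, ← mul_assoc]
    · exact ((hF.comp measurable_fst).sub_const _).add
        ((hF.comp measurable_fst).mul ((hosc n).comp measurable_fst))
  rw [ENNReal.tendsto_nhds_zero]
  intro ε hε
  have hε2 : 0 < ε / 2 := ENNReal.half_pos hε.ne'
  have hAB := hA.add hB
  rw [add_zero] at hAB
  obtain ⟨n, hn⟩ := ((ENNReal.tendsto_nhds_zero.1 hAB) (ε / 2) hε2).exists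
  have hC := ENNReal.Tendsto.const_mul (a := (n : ℝ≥0∞) * n) hcost (.inr (by finiteness))
  rw [mul_zero] at hC
  filter_upwards [(ENNReal.tendsto_nhds_zero.1 hC) (ε / 2) hε2] with i hi
  calc _ ≤ _ := hbound n i
    _ ≤ ε / 2 + ε / 2 := add_le_add hn hi
    _ = ε := ENNReal.add_halves ε

/-! ### Couplings of reweighted measures -/

lemma fst_withDensity_comp_fst {E : Type*} [MeasurableSpace E] (π : Measure (E × E))
    {f : E → ℝ≥0∞} (hf : Measurable f) :
    (π.withDensity fun z => f z.1).fst = π.fst.withDensity f := by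
  ext s hs
  rw [Measure.fst_apply hs, withDensity_apply _ (measurable_fst hs), withDensity_apply _ hs,
    Measure.fst, setLIntegral_map hs hf measurable_fst]

lemma snd_withDensity_comp_snd {E : Type*} [MeasurableSpace E] (π : Measure (E × E))
    {f : E → ℝ≥0∞} (hf : Measurable f) :
    (π.withDensity fun z => f z.2).snd = π.snd.withDensity f := by
  ext s hs
  rw [Measure.snd_apply hs, withDensity_apply _ (measurable_snd hs), withDensity_apply _ hs,
    Measure.snd, setLIntegral_map hs hf measurable_snd]

/-- A coupling `π` of `μ` and `ν` induces one of the reweighted measures `f μ` and `g ν`: the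
common part `min (f x) (g y) π` stays where `π` puts it, and the two remainders, which have equal
mass, are coupled independently. The remainders pay their `q`-th moments about `x₀`. -/
lemma exists_coupling_withDensity {E : Type*} [MetricSpace E] [MeasurableSpace E] [BorelSpace E]
    [SecondCountableTopology E] {q : ℝ} (hq : 0 ≤ q) {μ ν : Measure E} {π : Measure (E × E)}
    (hπ : π ∈ couplings μ ν) {f g : E → ℝ≥0∞} (hf : Measurable f) (hg : Measurable g)
    (hfμ : IsProbabilityMeasure (μ.withDensity f)) (hgν : IsProbabilityMeasure (ν.withDensity g))
    (x₀ : E) :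
    ∃ ρ ∈ couplings (μ.withDensity f) (ν.withDensity g),
      ∫⁻ z, edist z.1 z.2 ^ q ∂ρ ≤ ∫⁻ z, min (f z.1) (g z.2) * edist z.1 z.2 ^ q ∂π +
        2 ^ q * (∫⁻ z, (f z.1 - g z.2) * edist z.1 x₀ ^ q ∂π +
          ∫⁻ z, (g z.2 - f z.1) * edist z.2 x₀ ^ q ∂π) := by
  obtain ⟨-, hfst, hsnd⟩ := hπ
  have hf1 : Measurable fun z : E × E => f z.1 := hf.comp measurable_fst
  have hg2 : Measurable fun z : E × E => g z.2 := hg.comp measurable_snd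
  have hmin : Measurable fun z : E × E => min (f z.1) (g z.2) := hf1.min hg2
  have hfg : Measurable fun z : E × E => f z.1 - g z.2 := hf1.sub hg2
  have hgf : Measurable fun z : E × E => g z.2 - f z.1 := hg2.sub hf1
  set ρ₀ := π.withDensity fun z => min (f z.1) (g z.2) with hρ₀
  set α := π.withDensity fun z => f z.1 - g z.2 with hα
  set β := π.withDensity fun z => g z.2 - f z.1 with hβ
  have hα_add : ρ₀ + α = π.withDensity fun z => f z.1 := by
    rw [hρ₀, hα, ← withDensity_add_left hmin]
    congr 1
    ext z
    rcases le_total (f z.1) (g z.2) with h | h <;> simp [h, tsub_eq_zero_of_le]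
  have hβ_add : ρ₀ + β = π.withDensity fun z => g z.2 := by
    rw [hρ₀, hβ, ← withDensity_add_left hmin]
    congr 1
    ext z
    rcases le_total (f z.1) (g z.2) with h | h <;> simp [h, tsub_eq_zero_of_le]
  have hfst_add : ρ₀.fst + α.fst = μ.withDensity f := by
    rw [← Measure.fst_add, hα_add, fst_withDensity_comp_fst π hf, hfst]
  have hsnd_add : ρ₀.snd + β.snd = ν.withDensity g := by
    rw [← Measure.snd_add, hβ_add, snd_withDensity_comp_snd π hg, hsnd]
  have hα_mass : ρ₀ Set.univ + α Set.univ = 1 := by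
    rw [← Measure.fst_univ, ← Measure.fst_univ, ← Measure.add_apply, hfst_add, measure_univ]
  have hβ_mass : ρ₀ Set.univ + β Set.univ = 1 := by
    rw [← Measure.snd_univ, ← Measure.snd_univ, ← Measure.add_apply, hsnd_add, measure_univ]
  set m := α Set.univ with hm
  have hρ₀_top : ρ₀ Set.univ ≠ ∞ := ne_top_of_le_ne_top ENNReal.one_ne_top (hα_mass ▸ le_self_add)
  have hm_top : m ≠ ∞ := ne_top_of_le_ne_top ENNReal.one_ne_top (hα_mass ▸ le_add_self)
  have hmβ : β Set.univ = m :=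
    (ENNReal.add_right_inj hρ₀_top).1 (hβ_mass.trans hα_mass.symm)
  have : IsFiniteMeasure α := ⟨hm_top.lt_top⟩
  have : IsFiniteMeasure β := ⟨hmβ ▸ hm_top.lt_top⟩
  -- If `m = 0`, then both remainders vanish and `m⁻¹ • α.fst.prod β.snd` is the zero measure.
  have hfst' : (m⁻¹ • α.fst.prod β.snd).fst = α.fst := by
    rw [Measure.fst, Measure.map_smul, Measure.map_fst_prod, Measure.snd_univ, hmβ, smul_smul]
    rcases eq_or_ne m 0 with h | h
    · simp [Measure.measure_univ_eq_zero.1 (hm ▸ h)]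
    · rw [ENNReal.inv_mul_cancel h hm_top, one_smul]
  have hsnd' : (m⁻¹ • α.fst.prod β.snd).snd = β.snd := by
    rw [Measure.snd, Measure.map_smul, Measure.map_snd_prod, Measure.fst_univ, ← hm, smul_smul]
    rcases eq_or_ne m 0 with h | h
    · simp [Measure.measure_univ_eq_zero.1 (hmβ.trans h)]
    · rw [ENNReal.inv_mul_cancel h hm_top, one_smul]
  have hfstρ : (ρ₀ + m⁻¹ • α.fst.prod β.snd).fst = μ.withDensity f := by
    rw [Measure.fst_add, hfst', hfst_add]
  refine ⟨ρ₀ + m⁻¹ • α.fst.prod β.snd, ⟨⟨?_⟩, hfstρ, ?_⟩, ?_⟩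
  · rw [← Measure.fst_univ, hfstρ, measure_univ]
  · rw [Measure.snd_add, hsnd', hsnd_add]
  have hc : Measurable fun z : E × E => edist z.1 z.2 ^ q := by fun_prop
  have hG : Measurable fun x : E => edist x x₀ ^ q := by fun_prop
  have hcostα : ∫⁻ x, edist x x₀ ^ q ∂α.fst = ∫⁻ z, (f z.1 - g z.2) * edist z.1 x₀ ^ q ∂π := by
    rw [Measure.fst, lintegral_map hG measurable_fst]
    exact lintegral_withDensity_eq_lintegral_mul _ hfg (hG.comp measurable_fst)
  have hcostβ : ∫⁻ x, edist x x₀ ^ q ∂β.snd = ∫⁻ z, (g z.2 - f z.1) * edist z.2 x₀ ^ q ∂π := by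
    rw [Measure.snd, lintegral_map hG measurable_snd]
    exact lintegral_withDensity_eq_lintegral_mul _ hgf (hG.comp measurable_snd)
  rw [lintegral_add_measure, lintegral_smul_measure, ← hcostα, ← hcostβ, hρ₀,
    lintegral_withDensity_eq_lintegral_mul _ hmin hc]
  refine add_le_add le_rfl ?_
  have hprod : ∫⁻ z, edist z.1 z.2 ^ q ∂(α.fst.prod β.snd) ≤
      m * (2 ^ q * (∫⁻ x, edist x x₀ ^ q ∂α.fst + ∫⁻ x, edist x x₀ ^ q ∂β.snd)) := by
    calc ∫⁻ z, edist z.1 z.2 ^ q ∂(α.fst.prod β.snd)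
        = ∫⁻ x, ∫⁻ y, edist x y ^ q ∂β.snd ∂α.fst := lintegral_prod _ hc.aemeasurable
      _ ≤ ∫⁻ x, ∫⁻ y, 2 ^ q * (edist x x₀ ^ q + edist y x₀ ^ q) ∂β.snd ∂α.fst := by
        gcongr with x y
        simpa only [edist_comm x₀ y] using edist_rpow_le hq x x₀ y
      _ = m * (2 ^ q * (∫⁻ x, edist x x₀ ^ q ∂α.fst + ∫⁻ x, edist x x₀ ^ q ∂β.snd)) := by
        have h2 : (2 : ℝ≥0∞) ^ q ≠ ∞ := ENNReal.rpow_ne_top_of_nonneg hq (by simp)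
        simp_rw [lintegral_const_mul' _ _ h2, lintegral_add_left measurable_const,
          lintegral_const, Measure.snd_univ, hmβ]
        rw [lintegral_add_right _ measurable_const,
          lintegral_mul_const _ hG, lintegral_const, Measure.fst_univ, ← hm]
        ring
  calc m⁻¹ • ∫⁻ z, edist z.1 z.2 ^ q ∂(α.fst.prod β.snd)
      ≤ m⁻¹ * (m * (2 ^ q * (∫⁻ x, edist x x₀ ^ q ∂α.fst + ∫⁻ x, edist x x₀ ^ q ∂β.snd))) := by
        rw [smul_eq_mul]
        gcongr
    _ ≤ 1 * (2 ^ q * (∫⁻ x, edist x x₀ ^ q ∂α.fst + ∫⁻ x, edist x x₀ ^ q ∂β.snd)) := by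
        rw [← mul_assoc]
        gcongr
        exact ENNReal.inv_mul_le_one m
    _ = _ := one_mul _

/-! ### Posteriors -/

lemma integrable_exp_neg {E : Type*} [MetricSpace E] [MeasurableSpace E] [BorelSpace E]
    {Φ : E → ℝ} (hΦ_nonneg : ∀ x, 0 ≤ Φ x) (hΦ_cont : Continuous Φ) (ν : Measure E)
    [IsFiniteMeasure ν] : Integrable (fun x => Real.exp (-Φ x)) ν := by
  refine .of_bound (C := 1) (by fun_prop) (.of_forall fun x => ?_)
  rw [Real.norm_eq_abs, Real.abs_exp, Real.exp_le_one_iff]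
  linarith [hΦ_nonneg x]

lemma edist_exp_neg_le_one {E : Type*} {Φ : E → ℝ} (hΦ_nonneg : ∀ x, 0 ≤ Φ x) (x y : E) :
    edist (Real.exp (-Φ x)) (Real.exp (-Φ y)) ≤ 1 := by
  rw [edist_dist, Real.dist_eq, ENNReal.ofReal_le_one, abs_le]
  have h (x : E) : Real.exp (-Φ x) ≤ 1 := Real.exp_le_one_iff.2 (by linarith [hΦ_nonneg x])
  constructor <;> linarith [h x, h y, Real.exp_pos (-Φ x), Real.exp_pos (-Φ y)]

lemma isProbabilityMeasure_posterior {E : Type*} [MetricSpace E] [MeasurableSpace E] [BorelSpace E]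
    {Φ : E → ℝ} (hΦ_nonneg : ∀ x, 0 ≤ Φ x) (hΦ_cont : Continuous Φ)
    (ν : Measure E) [IsProbabilityMeasure ν] : IsProbabilityMeasure (posterior ν Φ) :=
  isProbabilityMeasure_tilted (integrable_exp_neg hΦ_nonneg hΦ_cont ν)

lemma exists_lintegral_edist_rpow_ne_top {E : Type*} [MetricSpace E] [MeasurableSpace E]
    {q : ℝ} (hq : 0 < q) {ν : Measure E}
    (hν : momentNorm q ν < ∞) : ∃ x₀, ∫⁻ x, edist x x₀ ^ q ∂ν ≠ ∞ := by
  obtain ⟨x₀, hx₀⟩ := iInf_lt_iff.1 hν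
  exact ⟨x₀, fun h => by simp [h, hq] at hx₀⟩

lemma exp_neg_div_integral_le {E : Type*} [MeasurableSpace E] {Φ : E → ℝ}
    (hΦ_nonneg : ∀ x, 0 ≤ Φ x) (ν : Measure E) (x : E) :
    Real.exp (-Φ x) / ∫ y, Real.exp (-Φ y) ∂ν ≤ (∫ y, Real.exp (-Φ y) ∂ν)⁻¹ := by
  rw [div_eq_mul_inv]
  refine mul_le_of_le_one_left ?_ (Real.exp_le_one_iff.2 (by linarith [hΦ_nonneg x]))
  exact inv_nonneg.2 (integral_nonneg fun y => (Real.exp_pos _).le)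

/-- The posterior is at most `Z⁻¹` times the prior, so it inherits its finite moments. -/
lemma posterior_mem_probMeasuresWithMoment {E : Type*} [MetricSpace E] [MeasurableSpace E]
    [BorelSpace E] {Φ : E → ℝ} {q : ℝ} (hq : 0 < q) (hΦ_nonneg : ∀ x, 0 ≤ Φ x)
    (hΦ_cont : Continuous Φ) {ν : Measure E} (hν : ν ∈ probMeasuresWithMoment E q) :
    posterior ν Φ ∈ probMeasuresWithMoment E q := by
  obtain ⟨hν_prob, hν_mom⟩ := hν
  obtain ⟨x₀, hx₀⟩ := exists_lintegral_edist_rpow_ne_top hq hν_mom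
  refine ⟨isProbabilityMeasure_posterior hΦ_nonneg hΦ_cont ν, ?_⟩
  refine (iInf_le _ x₀).trans_lt (ENNReal.rpow_lt_top_of_nonneg (by positivity) ?_)
  rw [posterior, lintegral_tilted]
  have hle : ∫⁻ x, ENNReal.ofReal (Real.exp (-Φ x) / ∫ y, Real.exp (-Φ y) ∂ν) * edist x x₀ ^ q ∂ν ≤
      ∫⁻ x, ENNReal.ofReal (∫ y, Real.exp (-Φ y) ∂ν)⁻¹ * edist x x₀ ^ q ∂ν := by
    gcongr with x
    exact exp_neg_div_integral_le hΦ_nonneg ν x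
  rw [lintegral_const_mul' _ _ ENNReal.ofReal_ne_top] at hle
  exact ne_top_of_le_ne_top (ENNReal.mul_ne_top ENNReal.ofReal_ne_top hx₀) hle

lemma edist_mul_mul_le_of_abs_le_one (a b c d : ℝ) (hb : |b| ≤ 1) :
    edist (a * c) (b * d) ≤ ENNReal.ofReal |c| * edist a b + edist c d := by
  rw [edist_dist, edist_dist, edist_dist, ← ENNReal.ofReal_mul (abs_nonneg c),
    ← ENNReal.ofReal_add (by positivity) dist_nonneg]
  refine ENNReal.ofReal_le_ofReal ?_
  rw [Real.dist_eq, Real.dist_eq, Real.dist_eq]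
  calc |a * c - b * d| = |c * (a - b) + b * (c - d)| := by ring_nf
    _ ≤ |c| * |a - b| + |b| * |c - d| := by
      rw [← abs_mul, ← abs_mul]
      exact abs_add_le _ _
    _ ≤ |c| * |a - b| + 1 * |c - d| := by gcongr
    _ = _ := by rw [one_mul]

lemma ofReal_tsub_le_edist (a b : ℝ) : ENNReal.ofReal a - ENNReal.ofReal b ≤ edist a b := by
  rw [tsub_le_iff_right, edist_dist]
  refine (ENNReal.ofReal_le_ofReal ?_).trans ENNReal.ofReal_add_le
  rw [Real.dist_eq]
  linarith [le_abs_self (a - b)]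

/-- The transport cost between posteriors, estimated through a coupling `π` of the priors: it is
controlled by the cost of `π`, by the weighted mean of `|exp (-Φ x) - exp (-Φ y)|` under `π`, and by
the difference of the inverse normalising constants. -/
lemma wassersteinDist_posterior_le {E : Type*} [MetricSpace E] [MeasurableSpace E] [BorelSpace E]
    [SecondCountableTopology E] {Φ : E → ℝ} {q : ℝ} (hq : 0 < q)
    (hΦ_nonneg : ∀ x, 0 ≤ Φ x) (hΦ_cont : Continuous Φ) {μ ν : Measure E} [IsProbabilityMeasure μ]
    [IsProbabilityMeasure ν] {π : Measure (E × E)} (hπ : π ∈ couplings μ ν) (x₀ : E) :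
    wassersteinDist q (posterior μ Φ) (posterior ν Φ) ≤
      (ENNReal.ofReal (∫ x, Real.exp (-Φ x) ∂μ)⁻¹ * ∫⁻ z, edist z.1 z.2 ^ q ∂π +
        2 ^ q * (2 * 2 ^ q) * (ENNReal.ofReal (∫ x, Real.exp (-Φ x) ∂μ)⁻¹ *
          (∫⁻ z, edist z.1 x₀ ^ q * edist (Real.exp (-Φ z.1)) (Real.exp (-Φ z.2)) ∂π +
            ∫⁻ z, edist z.1 z.2 ^ q ∂π) +
          edist (∫ x, Real.exp (-Φ x) ∂μ)⁻¹ (∫ x, Real.exp (-Φ x) ∂ν)⁻¹ *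
            (∫⁻ x, edist x x₀ ^ q ∂μ + ∫⁻ z, edist z.1 z.2 ^ q ∂π))) ^ (1 / q) := by
  set Zμ := ∫ x, Real.exp (-Φ x) ∂μ with hZμ
  set Zν := ∫ x, Real.exp (-Φ x) ∂ν with hZν
  set a := ENNReal.ofReal Zμ⁻¹ with ha
  set D := edist Zμ⁻¹ Zν⁻¹ with hD
  set f : E → ℝ≥0∞ := fun x => ENNReal.ofReal (Real.exp (-Φ x) / Zμ) with hf_def
  set g : E → ℝ≥0∞ := fun x => ENNReal.ofReal (Real.exp (-Φ x) / Zν) with hg_def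
  have hf : Measurable f := by fun_prop
  have hg : Measurable g := by fun_prop
  have hZμ0 : 0 ≤ Zμ := integral_nonneg fun x => (Real.exp_pos _).le
  have hfst : ∫⁻ x, edist x x₀ ^ q ∂μ = ∫⁻ z, edist z.1 x₀ ^ q ∂π := by
    rw [← hπ.2.1, Measure.fst, lintegral_map (by fun_prop) measurable_fst]
  obtain ⟨ρ, hρ, hρ_le⟩ := exists_coupling_withDensity hq.le hπ hf hg
    (isProbabilityMeasure_posterior hΦ_nonneg hΦ_cont μ)
    (isProbabilityMeasure_posterior hΦ_nonneg hΦ_cont ν) x₀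
  refine (iInf₂_le ρ hρ).trans ?_
  gcongr
  refine hρ_le.trans ?_
  -- Integrand dominating both remainder terms: `|f x - g y| ≤ a |ψ x - ψ y| + D`, and both
  -- `d(x, x₀)^q` and `d(y, x₀)^q` are at most `2 ^ q (d(x, x₀)^q + d(x, y)^q)`.
  set w : E × E → ℝ≥0∞ := fun z =>
    (a * edist (Real.exp (-Φ z.1)) (Real.exp (-Φ z.2)) + D) *
      (2 ^ q * (edist z.1 x₀ ^ q + edist z.1 z.2 ^ q)) with hw
  have hdist (z : E × E) : edist (Real.exp (-Φ z.1) / Zμ) (Real.exp (-Φ z.2) / Zν) ≤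
      a * edist (Real.exp (-Φ z.1)) (Real.exp (-Φ z.2)) + D := by
    rw [div_eq_mul_inv, div_eq_mul_inv]
    refine (edist_mul_mul_le_of_abs_le_one _ _ _ _ ?_).trans_eq ?_
    · rw [Real.abs_exp, Real.exp_le_one_iff]
      linarith [hΦ_nonneg z.2]
    · rw [abs_of_nonneg (inv_nonneg.2 hZμ0)]
  have h2q : (1 : ℝ≥0∞) ≤ 2 ^ q := ENNReal.one_le_rpow (by norm_num) hq
  have hα : ∫⁻ z, (f z.1 - g z.2) * edist z.1 x₀ ^ q ∂π ≤ ∫⁻ z, w z ∂π := by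
    refine lintegral_mono fun z => mul_le_mul' ((ofReal_tsub_le_edist _ _).trans (hdist z)) ?_
    exact le_self_add.trans (le_mul_of_one_le_left' h2q)
  have hβ : ∫⁻ z, (g z.2 - f z.1) * edist z.2 x₀ ^ q ∂π ≤ ∫⁻ z, w z ∂π := by
    refine lintegral_mono fun z => mul_le_mul' ((ofReal_tsub_le_edist _ _).trans ?_) ?_
    · rw [edist_comm]
      exact hdist z
    · rw [add_comm, edist_comm z.1 z.2]
      exact edist_rpow_le hq.le z.2 z.1 x₀
  have h2top : (2 : ℝ≥0∞) ^ q ≠ ∞ := ENNReal.rpow_ne_top_of_nonneg hq.le (by simp)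
  have hDtop : D ≠ ∞ := edist_ne_top _ _
  have hatop : a ≠ ∞ := ENNReal.ofReal_ne_top
  have hw_le : ∫⁻ z, w z ∂π ≤ 2 ^ q *
      (a * (∫⁻ z, edist z.1 x₀ ^ q * edist (Real.exp (-Φ z.1)) (Real.exp (-Φ z.2)) ∂π +
        ∫⁻ z, edist z.1 z.2 ^ q ∂π) +
        D * (∫⁻ z, edist z.1 x₀ ^ q ∂π + ∫⁻ z, edist z.1 z.2 ^ q ∂π)) := by
    rw [← lintegral_add_left (by fun_prop), ← lintegral_add_left (by fun_prop),
      ← lintegral_const_mul' _ _ hatop, ← lintegral_const_mul' _ _ hDtop,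
      ← lintegral_add_left (by fun_prop), ← lintegral_const_mul' _ _ h2top]
    refine lintegral_mono fun z => ?_
    have h1 := edist_exp_neg_le_one hΦ_nonneg z.1 z.2
    calc w z = 2 ^ q * (a * (edist z.1 x₀ ^ q * edist (Real.exp (-Φ z.1)) (Real.exp (-Φ z.2)) +
          edist z.1 z.2 ^ q * edist (Real.exp (-Φ z.1)) (Real.exp (-Φ z.2))) +
          D * (edist z.1 x₀ ^ q + edist z.1 z.2 ^ q)) := by
          rw [hw]
          ring
      _ ≤ _ := by
          gcongr
          exact mul_le_of_le_one_right' h1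
  rw [hfst]
  refine add_le_add ?_ ?_
  · rw [← lintegral_const_mul' _ _ hatop]
    gcongr with z
    exact (min_le_left _ _).trans
      (ENNReal.ofReal_le_ofReal (exp_neg_div_integral_le hΦ_nonneg μ z.1))
  · rw [mul_assoc (2 ^ q) (2 * 2 ^ q), mul_assoc 2 (2 ^ q), two_mul]
    gcongr
    · exact hα.trans hw_le
    · exact hβ.trans hw_le

lemma edist_integral_exp_neg_le {E : Type*} [MetricSpace E] [MeasurableSpace E] [BorelSpace E]
    [SecondCountableTopology E] {Φ : E → ℝ} (hΦ_nonneg : ∀ x, 0 ≤ Φ x)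
    (hΦ_cont : Continuous Φ) {μ ν : Measure E} {π : Measure (E × E)} (hπ : π ∈ couplings μ ν) :
    edist (∫ x, Real.exp (-Φ x) ∂μ) (∫ x, Real.exp (-Φ x) ∂ν) ≤
      ∫⁻ z, edist (Real.exp (-Φ z.1)) (Real.exp (-Φ z.2)) ∂π := by
  obtain ⟨hprob, rfl, rfl⟩ := hπ
  have h1 := integrable_exp_neg hΦ_nonneg hΦ_cont π.fst
  have h2 := integrable_exp_neg hΦ_nonneg hΦ_cont π.snd
  rw [Measure.fst] at h1 ⊢
  rw [Measure.snd] at h2 ⊢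
  rw [integral_map measurable_fst.aemeasurable h1.aestronglyMeasurable,
    integral_map measurable_snd.aemeasurable h2.aestronglyMeasurable, edist_eq_enorm_sub,
    ← integral_sub (f := fun z : E × E => Real.exp (-Φ z.1)) (g := fun z => Real.exp (-Φ z.2))
      (h1.comp_measurable measurable_fst) (h2.comp_measurable measurable_snd)]
  simp_rw [edist_eq_enorm_sub]
  exact enorm_integral_le_lintegral_enorm _

/-! ### Stability of posteriors -/

lemma exists_coupling_lt_of_wassersteinDist_lt {E : Type*} [MetricSpace E] [MeasurableSpace E]
    {q : ℝ} {μ ν : Measure E} {r : ℝ≥0∞} (h : wassersteinDist q μ ν < r) :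
    ∃ π ∈ couplings μ ν, (∫⁻ z, edist z.1 z.2 ^ q ∂π) ^ (1 / q) < r := by
  simpa only [wassersteinDist, iInf_lt_iff, exists_prop] using h

/-- Almost optimal couplings: a vanishing Wasserstein distance is witnessed by couplings whose
costs vanish. -/
lemma exists_couplings_tendsto_zero {E : Type*} [MetricSpace E] [MeasurableSpace E] {q : ℝ}
    (hq : 0 < q) {μ : Measure E} [IsProbabilityMeasure μ] {μt : ℕ → Measure E}
    (hμt : ∀ k, IsProbabilityMeasure (μt k))
    (h : Tendsto (fun k => wassersteinDist q μ (μt k)) atTop (𝓝 0)) :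
    ∃ π : ℕ → Measure (E × E), (∀ k, π k ∈ couplings μ (μt k)) ∧
      Tendsto (fun k => ∫⁻ z, edist z.1 z.2 ^ q ∂π k) atTop (𝓝 0) := by
  have hex (k : ℕ) : ∃ π ∈ couplings μ (μt k), (∫⁻ z, edist z.1 z.2 ^ q ∂π) ^ (1 / q) ≤
      wassersteinDist q μ (μt k) + ((k : ℝ≥0∞) + 1)⁻¹ := by
    rcases eq_or_ne (wassersteinDist q μ (μt k)) ∞ with htop | htop
    · refine ⟨μ.prod (μt k), ⟨inferInstance, Measure.fst_prod, Measure.snd_prod⟩, ?_⟩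
      simp [htop]
    · obtain ⟨π, hπ, hlt⟩ := exists_coupling_lt_of_wassersteinDist_lt
        (ENNReal.lt_add_right htop (ENNReal.inv_ne_zero.2 (by finiteness : (k : ℝ≥0∞) + 1 ≠ ∞)))
      exact ⟨π, hπ, hlt.le⟩
  choose π hπ hle using hex
  refine ⟨π, hπ, ?_⟩
  have hinv : Tendsto (fun k : ℕ => ((k : ℝ≥0∞) + 1)⁻¹) atTop (𝓝 0) := by
    have := (tendsto_add_atTop_iff_nat 1).2 ENNReal.tendsto_inv_nat_nhds_zero
    simpa using this
  have hroot := tendsto_of_tendsto_of_tendsto_of_le_of_le tendsto_const_nhds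
    (by simpa using h.add hinv) (fun k => zero_le) hle
  have := hroot.ennrpow_const q
  simpa [ENNReal.zero_rpow_of_pos hq, ← ENNReal.rpow_mul, hq.ne'] using this

theorem mainTheorem9 {E : Type*} [MetricSpace E] [CompleteSpace E]
    [TopologicalSpace.SeparableSpace E] [MeasurableSpace E] [BorelSpace E]
    (q : ℝ) (hq : 0 < q)
    (Φ : E → ℝ) (hΦ_nonneg : ∀ x, 0 ≤ Φ x) (hΦ_cont : Continuous Φ)
    (μ : Measure E) (hμ : μ ∈ probMeasuresWithMoment E q)
    (μt : ℕ → Measure E) (hμt : ∀ k, μt k ∈ probMeasuresWithMoment E q) :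
    posterior μ Φ ∈ probMeasuresWithMoment E q ∧
    (∀ k, posterior (μt k) Φ ∈ probMeasuresWithMoment E q) ∧
    (Tendsto (fun k => wassersteinDist q μ (μt k)) atTop (𝓝 0) →
      Tendsto (fun k => wassersteinDist q (posterior μ Φ) (posterior (μt k) Φ)) atTop (𝓝 0)) := by
  refine ⟨posterior_mem_probMeasuresWithMoment hq hΦ_nonneg hΦ_cont hμ,
    fun k => posterior_mem_probMeasuresWithMoment hq hΦ_nonneg hΦ_cont (hμt k), fun hW => ?_⟩
  have : SecondCountableTopology E := UniformSpace.secondCountable_of_separable E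
  have hμ_prob : IsProbabilityMeasure μ := hμ.1
  have hμt_prob (k : ℕ) : IsProbabilityMeasure (μt k) := (hμt k).1
  obtain ⟨x₀, hx₀⟩ := exists_lintegral_edist_rpow_ne_top hq hμ.2
  obtain ⟨π, hπ, hcost⟩ := exists_couplings_tendsto_zero hq hμt_prob hW
  have hψ : Continuous fun x => Real.exp (-Φ x) := by fun_prop
  have hψ1 := edist_exp_neg_le_one hΦ_nonneg
  have hweighted := tendsto_lintegral_mul_edist hq hψ hψ1 (fun k => (hπ k).2.1) hcost
    (F := fun x => edist x x₀ ^ q) (by fun_prop)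
    (fun x => ENNReal.rpow_ne_top_of_nonneg hq.le (edist_ne_top _ _)) hx₀
  have hunweighted := tendsto_lintegral_mul_edist hq hψ hψ1 (fun k => (hπ k).2.1) hcost
    (F := fun _ => 1) measurable_const (fun _ => ENNReal.one_ne_top) (by simp)
  simp only [one_mul] at hunweighted
  have hZ : Tendsto (fun k => ∫ x, Real.exp (-Φ x) ∂μt k) atTop (𝓝 (∫ x, Real.exp (-Φ x) ∂μ)) := by
    rw [tendsto_iff_edist_tendsto_0]
    refine tendsto_of_tendsto_of_tendsto_of_le_of_le tendsto_const_nhds hunweighted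
      (fun k => zero_le) fun k => ?_
    rw [edist_comm]
    exact edist_integral_exp_neg_le hΦ_nonneg hΦ_cont (hπ k)
  have hZ_pos : 0 < ∫ x, Real.exp (-Φ x) ∂μ :=
    integral_exp_pos (integrable_exp_neg hΦ_nonneg hΦ_cont μ)
  have hD := tendsto_iff_edist_tendsto_0.1 (hZ.inv₀ hZ_pos.ne')
  simp only [edist_comm _ (∫ x, Real.exp (-Φ x) ∂μ)⁻¹] at hD
  have hatop : ENNReal.ofReal (∫ x, Real.exp (-Φ x) ∂μ)⁻¹ ≠ ∞ := ENNReal.ofReal_ne_top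
  have h2top : (2 : ℝ≥0∞) ^ q ≠ ∞ := ENNReal.rpow_ne_top_of_nonneg hq.le (by simp)
  have hsum := (ENNReal.Tendsto.const_mul hcost (.inr hatop)).add
    (ENNReal.Tendsto.const_mul ((ENNReal.Tendsto.const_mul (hweighted.add hcost) (.inr hatop)).add
      (ENNReal.Tendsto.mul hD (.inr (by simpa using hx₀))
        (tendsto_const_nhds.add hcost) (.inr ENNReal.zero_ne_top)))
      (.inr (by finiteness : (2 : ℝ≥0∞) ^ q * (2 * 2 ^ q) ≠ ∞)))
  have hroot := hsum.ennrpow_const (1 / q)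
  simp only [add_zero, mul_zero, zero_mul, ENNReal.zero_rpow_of_pos (one_div_pos.2 hq)] at hroot
  exact tendsto_of_tendsto_of_tendsto_of_le_of_le tendsto_const_nhds hroot (fun k => zero_le)
    fun k => wassersteinDist_posterior_le hq hΦ_nonneg hΦ_cont (hπ k) x₀
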